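/- Let $M$ be a von Neumann algebra on a complex Hilbert space. Call a functional on $M$ normal if it is ultraweakly continuous, and order the hermitian normal functionals by $\varphi\le\psi$ iff $\psi-\varphi$ is positive. For a hermitian normal functional $\varphi$ let $\varphi=\varphi^+-\varphi^-$ be its Jordan decomposition (the unique one into positive normal functionals with $\|\varphi\|=\|\varphi^+\|+\|\varphi^-\|$), and let $|\varphi|$ be its absolute value, i.e. the positive normal functional in its polar decomposition $\varphi=u|\varphi|$ (where $(u|\varphi|)(y)=|\varphi|(uy)$). For a positive element $a\in M$ the following conditions are equivalent: (i) $a$ lies in the center of $M$; (ii) $pap\le a$ for every projection $p\in M$; (iii) $\varphi^+(a)\le\varphi_1(a)$ for every hermitian normal functional $\varphi$ and every decomposition $\varphi=\varphi_1-\varphi_2$ with $\varphi_1,\varphi_2$ positive normal functionals; (iv) the map $\varphi\mapsto\varphi^+(a)$ on hermitian normal functionals is monotone: $\varphi\le\psi$ implies $\varphi^+(a)\le\psi^+(a)$; (v) the map $\varphi\mapsto\varphi^+(a)$ on hermitian normal functionals is subadditive: $(\varphi+\psi)^+(a)\le\varphi^+(a)+\psi^+(a)$ for all $\varphi,\psi$;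 (vi) the map $\varphi\mapsto|\varphi|(a)$ on hermitian normal functionals is subadditive: $|\varphi+\psi|(a)\le|\varphi|(a)+|\psi|(a)$ for all $\varphi,\psi$; (vii) the map $\varphi\mapsto\varphi^+(a)$ on the real vector space of hermitian normal functionals is convex; (viii) the map $\varphi\mapsto|\varphi|(a)$ on the real vector space of hermitian normal functionals is convex. -/

import Mathlib

open scoped ComplexOrder InnerProductSpace

namespace VonNeumannAlgebra

variable {H : Type*} [NormedAddCommGroup H] [InnerProductSpace ℂ H] [CompleteSpace H]
  {M : VonNeumannAlgebra H}

/-- Bounded linear functionals on the von Neumann algebra `M`, with the operator norm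
(every normal functional is bounded). -/
abbrev Functional (M : VonNeumannAlgebra H) : Type _ := StrongDual ℂ M.toStarSubalgebra

/-- A functional is normal (ultraweakly continuous) if it has the form
`x ↦ ∑ₙ ⟪ξₙ, x ηₙ⟫` with `∑ₙ ‖ξₙ‖² < ∞` and `∑ₙ ‖ηₙ‖² < ∞`. -/
def IsNormal (φ : Functional M) : Prop :=
  ∃ ξ η : ℕ → H, Summable (fun n => ‖ξ n‖ ^ 2) ∧ Summable (fun n => ‖η n‖ ^ 2) ∧
    ∀ x : M.toStarSubalgebra, HasSum (fun n => ⟪ξ n, (x : H →L[ℂ] H) (η n)⟫_ℂ) (φ x)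

/-- A functional is positive if it is nonnegative on the positive operators of `M`. -/
def IsPos (φ : Functional M) : Prop :=
  ∀ x : M.toStarSubalgebra, 0 ≤ (x : H →L[ℂ] H) → 0 ≤ φ x

/-- A functional is hermitian if `φ (x*)` is the complex conjugate of `φ x`. -/
def IsHerm (φ : Functional M) : Prop :=
  ∀ x : M.toStarSubalgebra, φ (star x) = star (φ x)

/-- The set of all hermitian normal functionals. -/
def hermNormal (M : VonNeumannAlgebra H) : Set (Functional M) :=
  {φ | IsNormal φ ∧ IsHerm φ}

/-- The set of all positive normal functionals. -/
def posNormal (M : VonNeumannAlgebra H) : Set (Functional M) :=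
  {φ | IsNormal φ ∧ IsPos φ}

/-- `φ = φ₁ - φ₂` is the Jordan decomposition of `φ`: both terms are positive normal functionals
and `‖φ‖ = ‖φ₁‖ + ‖φ₂‖`. Every hermitian normal functional has exactly one. -/
def IsJordanDecomposition (φ φ₁ φ₂ : Functional M) : Prop :=
  φ₁ ∈ posNormal M ∧ φ₂ ∈ posNormal M ∧ φ = φ₁ - φ₂ ∧ ‖φ‖ = ‖φ₁‖ + ‖φ₂‖

/-- The positive part `φ⁺` of a hermitian normal functional `φ`: the first term of its Jordan
decomposition. -/
noncomputable def posPart (φ : Functional M) : Functional M :=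
  Classical.epsilon fun φ₁ => ∃ φ₂, IsJordanDecomposition φ φ₁ φ₂

/-- `φ = u ω` is a polar decomposition of `φ`: the functional `ω` is positive and normal, `u` is a
partial isometry in `M`, and `φ = u ω`, `ω = u* φ`, where `x φ` denotes `y ↦ φ (x y)`.
Every normal `φ` has one, and `ω` is determined by `φ` (the usual further requirement that `u u*`
be the support of `ω` only serves to make `u` unique as well). -/
def IsPolarDecomposition (φ : Functional M) (u : M.toStarSubalgebra) (ω : Functional M) : Prop :=
  ω ∈ posNormal M ∧ u * star u * u = u ∧ (∀ y, φ y = ω (u * y)) ∧ ∀ y, ω y = φ (star u * y)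

/-- The absolute value `|φ|` of a normal functional `φ`: the positive factor of its polar
decomposition. -/
noncomputable def absVal (φ : Functional M) : Functional M :=
  Classical.epsilon fun ω => ∃ u, IsPolarDecomposition φ u ω

end VonNeumannAlgebra

/-! Everything rests on a concrete Jordan decomposition (`exists_isOrthogonalDecomposition`): for
hermitian normal φ there is a projection p in M with φ⁺ = φ(p · p), φ⁻ = -φ((1-p) · (1-p)) and |φ| =
φ⁺ + φ⁻. Such a p maximizes Re φ over the positive contractions of M: weak compactness gives a
maximizer e, all its positive powers are maximizers, and by the mean ergodic theorem their Cesàro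
means tend to a projection. Then φ attains its norm at 2p - 1, so φ((2p-1) ·) is positive.
Cauchy–Schwarz gives uniqueness, so the choices made in `posPart` and `absVal` are the expected
functionals.

If pap ≤ a for all p, then φ⁺(a) = φ₁(pap) - φ₂(pap) ≤ φ₁(a), which is (iii). Conversely, for a
vector functional ω and c = sp + s⁻¹(1-p), the mixed terms of ω - ω(c · c) cancel, its positive part
is (1-s²)ω(p · p), and s → 0 in (iii) gives ω(pap) ≤ ω(a). For (i), pap ≤ a forces pa = ap, and
dyadic sums of projections approximate every positive contraction in norm. Conditions (iv) and (v)
rearrange (iii); |φ| = 2φ⁺ - φ links (v) to (vi), and positive homogeneity identifies subadditivity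
with convexity. -/

namespace VonNeumannAlgebra

open Filter Topology

/-! ### Normal functionals and their stability. -/

section Normal

variable {H : Type*} [NormedAddCommGroup H] [InnerProductSpace ℂ H] [CompleteSpace H]
  {M : VonNeumannAlgebra H}

/-- The functional `x ↦ φ (c x d)`. -/
noncomputable def compression (c d : M.toStarSubalgebra) (φ : Functional M) : Functional M :=
  φ.comp ((ContinuousLinearMap.mul ℂ M.toStarSubalgebra c).comp
    ((ContinuousLinearMap.mul ℂ M.toStarSubalgebra).flip d))

@[simp]
theorem compression_apply (c d : M.toStarSubalgebra) (φ : Functional M) (x : M.toStarSubalgebra) :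
    compression c d φ x = φ (c * (x * d)) := rfl

/-- The functional `x ↦ ⟪ξ, x ξ⟫`. -/
noncomputable def vectorFunctional (M : VonNeumannAlgebra H) (ξ : H) : Functional M :=
  LinearMap.mkContinuous
    { toFun := fun x => ⟪ξ, (x : H →L[ℂ] H) ξ⟫_ℂ
      map_add' := fun x y => by simp
      map_smul' := fun c x => by simp } (‖ξ‖ * ‖ξ‖) fun x => by
    refine (norm_inner_le_norm _ _).trans ?_
    calc ‖ξ‖ * ‖(x : H →L[ℂ] H) ξ‖ ≤ ‖ξ‖ * (‖x‖ * ‖ξ‖) := by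
          gcongr; exact (x : H →L[ℂ] H).le_opNorm ξ
      _ = _ := by ring

omit [CompleteSpace H] in
theorem summable_norm_sq_map {ξ : ℕ → H} (hξ : Summable fun n => ‖ξ n‖ ^ 2) (T : H →L[ℂ] H) :
    Summable fun n => ‖T (ξ n)‖ ^ 2 := by
  refine Summable.of_nonneg_of_le (fun n => by positivity) (fun n => ?_) (hξ.mul_left (‖T‖ ^ 2))
  rw [← mul_pow]
  gcongr
  exact T.le_opNorm _

theorem IsNormal.add {φ ψ : Functional M} (hφ : IsNormal φ) (hψ : IsNormal ψ) :
    IsNormal (φ + ψ) := by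
  obtain ⟨ξ, η, hξ, hη, h⟩ := hφ
  obtain ⟨ξ', η', hξ', hη', h'⟩ := hψ
  refine ⟨fun n => Sum.elim ξ ξ' (Equiv.natSumNatEquivNat.symm n),
    fun n => Sum.elim η η' (Equiv.natSumNatEquivNat.symm n), ?_, ?_, fun x => ?_⟩
  · exact (Equiv.natSumNatEquivNat.symm.summable_iff (f := fun s => ‖Sum.elim ξ ξ' s‖ ^ 2)).2
      (Summable.sum _ hξ hξ')
  · exact (Equiv.natSumNatEquivNat.symm.summable_iff (f := fun s => ‖Sum.elim η η' s‖ ^ 2)).2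
      (Summable.sum _ hη hη')
  · exact (Equiv.natSumNatEquivNat.symm.hasSum_iff
      (f := fun s => ⟪Sum.elim ξ ξ' s, (x : H →L[ℂ] H) (Sum.elim η η' s)⟫_ℂ)).2
      (HasSum.sum (h x) (h' x))

theorem IsNormal.smul {φ : Functional M} (hφ : IsNormal φ) (c : ℂ) : IsNormal (c • φ) := by
  obtain ⟨ξ, η, hξ, hη, h⟩ := hφ
  refine ⟨ξ, fun n => c • η n, hξ, ?_, fun x => ?_⟩
  · simpa [norm_smul, mul_pow] using hη.mul_left (‖c‖ ^ 2)
  · simpa [inner_smul_right] using (h x).mul_left c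

theorem IsNormal.neg {φ : Functional M} (hφ : IsNormal φ) : IsNormal (-φ) := by
  rw [← neg_one_smul ℂ φ]
  exact hφ.smul (-1)

theorem IsNormal.sub {φ ψ : Functional M} (hφ : IsNormal φ) (hψ : IsNormal ψ) :
    IsNormal (φ - ψ) := by
  simpa [sub_eq_add_neg] using hφ.add hψ.neg

theorem IsNormal.compression {φ : Functional M} (hφ : IsNormal φ) (c d : M.toStarSubalgebra) :
    IsNormal (compression c d φ) := by
  obtain ⟨ξ, η, hξ, hη, h⟩ := hφ
  refine ⟨fun n => star (c : H →L[ℂ] H) (ξ n), fun n => (d : H →L[ℂ] H) (η n),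
    summable_norm_sq_map hξ _, summable_norm_sq_map hη _, fun x => ?_⟩
  simpa [ContinuousLinearMap.star_eq_adjoint, ContinuousLinearMap.adjoint_inner_left]
    using h (c * (x * d))

theorem isNormal_vectorFunctional (ξ : H) : IsNormal (vectorFunctional M ξ) := by
  have hs : Summable fun n : ℕ => ‖(Pi.single 0 ξ : ℕ → H) n‖ ^ 2 :=
    summable_of_ne_finset_zero (s := {0}) fun n hn => by
      simp [Pi.single_eq_of_ne (Finset.notMem_singleton.1 hn)]
  refine ⟨Pi.single 0 ξ, Pi.single 0 ξ, hs, hs, fun x => ?_⟩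
  convert! hasSum_single (f := fun n : ℕ =>
    ⟪(Pi.single 0 ξ : ℕ → H) n, (x : H →L[ℂ] H) ((Pi.single 0 ξ : ℕ → H) n)⟫_ℂ) 0
    (fun n hn => by simp [Pi.single_eq_of_ne hn]) using 1

/-- Dominated convergence for the defining series: on bounded sets, weak operator convergence
suffices. -/
theorem IsNormal.tendsto {φ : Functional M} (hφ : IsNormal φ) {ι : Type*} {l : Filter ι}
    {y : ι → M.toStarSubalgebra} {z : M.toStarSubalgebra} {C : ℝ} (hy : ∀ i, ‖y i‖ ≤ C)
    (h : ∀ a b : H, Tendsto (fun i => ⟪a, (y i : H →L[ℂ] H) b⟫_ℂ) l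
      (𝓝 ⟪a, (z : H →L[ℂ] H) b⟫_ℂ)) :
    Tendsto (fun i => φ (y i)) l (𝓝 (φ z)) := by
  obtain ⟨ξ, η, hξ, hη, hs⟩ := hφ
  rw [← (hs z).tsum_eq]
  simp_rw [fun i => (hs (y i)).tsum_eq.symm]
  refine tendsto_tsum_of_dominated_convergence ((hξ.add hη).mul_left C) (fun k => h _ _)
    (Eventually.of_forall fun i k => ?_)
  have hC : 0 ≤ C := (norm_nonneg _).trans (hy i)
  calc ‖⟪ξ k, (y i : H →L[ℂ] H) (η k)⟫_ℂ‖ ≤ ‖ξ k‖ * ‖(y i : H →L[ℂ] H) (η k)‖ :=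
        norm_inner_le_norm _ _
    _ ≤ ‖ξ k‖ * (C * ‖η k‖) := by
        gcongr; exact (y i : H →L[ℂ] H).le_of_opNorm_le (hy i) _
    _ = C * (‖ξ k‖ * ‖η k‖) := by ring
    _ ≤ C * (‖ξ k‖ ^ 2 + ‖η k‖ ^ 2) := by
        gcongr; nlinarith [sq_nonneg (‖ξ k‖ - ‖η k‖), sq_nonneg (‖ξ k‖), sq_nonneg (‖η k‖)]

end Normal

/-! ### Weak operator limits of bounded families. -/

section WeakLimits

variable {H : Type*} [NormedAddCommGroup H] [InnerProductSpace ℂ H] [CompleteSpace H]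

/-- Bounded families of operators converge weakly along ultrafilters. -/
theorem exists_weak_limit {ι : Type*} (U : Ultrafilter ι) (e : ι → H →L[ℂ] H) {C : ℝ}
    (he : ∀ i, ‖e i‖ ≤ C) :
    ∃ z : H →L[ℂ] H, ∀ a b : H, Tendsto (fun i => ⟪a, e i b⟫_ℂ) U (𝓝 ⟪a, z b⟫_ℂ) := by
  have hb : ∀ i a b, ‖⟪e i a, b⟫_ℂ‖ ≤ C * ‖a‖ * ‖b‖ := fun i a b =>
    (norm_inner_le_norm _ _).trans (by gcongr; exact (e i).le_of_opNorm_le (he i) _)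
  have hlim : ∀ a b : H, ∃ w : ℂ, ‖w‖ ≤ C * ‖a‖ * ‖b‖ ∧
      Tendsto (fun i => ⟪e i a, b⟫_ℂ) U (𝓝 w) := fun a b => by
    obtain ⟨w, hw, hw'⟩ := (isCompact_closedBall (0 : ℂ) (C * ‖a‖ * ‖b‖)).ultrafilter_le_nhds'
      (U.map fun i => ⟪e i a, b⟫_ℂ) (by
        rw [Ultrafilter.mem_map]
        exact Filter.univ_mem' fun i => by simpa using hb i a b)
    exact ⟨w, by simpa using hw, hw'⟩
  choose B hB hBt using hlim
  -- The pointwise limits form a bounded sesquilinear form, represented by an operator in the first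
  -- slot of the inner product; conjugation then moves it to the second.
  let F : H →ₗ⋆[ℂ] H →ₗ[ℂ] ℂ := LinearMap.mk₂'ₛₗ _ _ B
    (fun a a' b => tendsto_nhds_unique (hBt _ _)
      (by simpa [inner_add_left] using (hBt a b).add (hBt a' b)))
    (fun c a b => tendsto_nhds_unique (hBt _ _)
      (by simpa [inner_smul_left, mul_comm] using (hBt a b).const_mul (starRingEnd ℂ c)))
    (fun a b b' => tendsto_nhds_unique (hBt _ _)
      (by simpa [inner_add_right] using (hBt a b).add (hBt a b')))
    (fun c a b => tendsto_nhds_unique (hBt _ _)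
      (by simpa [inner_smul_right] using (hBt a b).const_mul c))
  refine ⟨InnerProductSpace.continuousLinearMapOfBilin (F.mkContinuous₂ C hB), fun a b => ?_⟩
  have h := (hBt b a).star
  have h2 : B b a = ⟪InnerProductSpace.continuousLinearMapOfBilin (F.mkContinuous₂ C hB) b, a⟫_ℂ := by
    rw [InnerProductSpace.continuousLinearMapOfBilin_apply]; rfl
  rw [h2] at h
  simpa only [← starRingEnd_apply, inner_conj_symm] using h

omit [CompleteSpace H] in
theorem nonneg_iff_inner {T : H →L[ℂ] H} : 0 ≤ T ↔ ∀ x, 0 ≤ ⟪x, T x⟫_ℂ := by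
  rw [ContinuousLinearMap.nonneg_iff_isPositive]
  refine ⟨fun h => h.inner_nonneg_right, fun h => ?_⟩
  rw [ContinuousLinearMap.isPositive_iff_complex]
  intro x
  have hx := h x
  rw [← inner_conj_symm, starRingEnd_apply, star_nonneg_iff, Complex.nonneg_iff] at hx
  exact ⟨Complex.ext rfl hx.2, hx.1⟩

omit [CompleteSpace H] in
theorem nonneg_of_weak_limit {ι : Type*} {l : Filter ι} [l.NeBot] {e : ι → H →L[ℂ] H}
    {z : H →L[ℂ] H} (he : ∀ i, 0 ≤ e i)
    (h : ∀ a b : H, Tendsto (fun i => ⟪a, e i b⟫_ℂ) l (𝓝 ⟪a, z b⟫_ℂ)) : 0 ≤ z := by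
  refine nonneg_iff_inner.2 fun x => ge_of_tendsto (h x x) (Eventually.of_forall fun i => ?_)
  exact nonneg_iff_inner.1 (he i) x

/-- By the bicommutant property: commuting with a fixed operator passes to weak limits. -/
theorem mem_of_weak_limit {M : VonNeumannAlgebra H} {ι : Type*} {l : Filter ι} [l.NeBot]
    {e : ι → H →L[ℂ] H} {z : H →L[ℂ] H} (he : ∀ i, e i ∈ M)
    (h : ∀ a b : H, Tendsto (fun i => ⟪a, e i b⟫_ℂ) l (𝓝 ⟪a, z b⟫_ℂ)) : z ∈ M := by
  rw [← M.commutant_commutant, mem_commutant_iff]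
  intro g hg
  ext b
  refine ext_inner_left ℂ fun a => ?_
  refine tendsto_nhds_unique ?_ (h a (g b))
  have := h (ContinuousLinearMap.adjoint g a) b
  simp only [ContinuousLinearMap.adjoint_inner_left] at this
  refine this.congr fun i => ?_
  exact congr(⟪a, $(mem_commutant_iff.1 hg _ (he i)) b⟫_ℂ).symm

end WeakLimits

/-! ### Positive and hermitian functionals. -/

section Positive

open ComplexStarModule

variable {H : Type*} [NormedAddCommGroup H] [InnerProductSpace ℂ H] [CompleteSpace H]
  {M : VonNeumannAlgebra H}

theorem star_mul_self_coe_nonneg (x : M.toStarSubalgebra) :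
    0 ≤ ((star x * x : M.toStarSubalgebra) : H →L[ℂ] H) :=
  star_mul_self_nonneg (x : H →L[ℂ] H)

theorem norm_one_coe_le : ‖(1 : M.toStarSubalgebra)‖ ≤ 1 :=
  ContinuousLinearMap.norm_id_le

theorem le_norm_smul_one {x : M.toStarSubalgebra} (hx : IsSelfAdjoint x) :
    (x : H →L[ℂ] H) ≤ ((((‖x‖ : ℝ) : ℂ) • (1 : M.toStarSubalgebra) : M.toStarSubalgebra) :
      H →L[ℂ] H) := by
  have h : IsSelfAdjoint (x : H →L[ℂ] H) := congr_arg Subtype.val hx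
  have := h.le_algebraMap_norm_self
  rw [Algebra.algebraMap_eq_smul_one] at this
  exact this

theorem IsPos.mono {ω : Functional M} (hω : IsPos ω) {x y : M.toStarSubalgebra}
    (h : (x : H →L[ℂ] H) ≤ y) : ω x ≤ ω y := by
  have := hω (y - x) (sub_nonneg.2 h)
  rwa [map_sub, sub_nonneg] at this

theorem IsPos.isHerm {ω : Functional M} (hω : IsPos ω) : IsHerm ω := by
  have hsa : ∀ x : M.toStarSubalgebra, IsSelfAdjoint x → star (ω x) = ω x := fun x hx => by
    have h1 : 0 ≤ ω (((‖x‖ : ℝ) : ℂ) • 1) := hω _ (by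
      have h0 : (0 : H →L[ℂ] H) ≤ ‖x‖ • (1 : H →L[ℂ] H) := smul_nonneg (norm_nonneg _) zero_le_one
      exact h0)
    have h2 := hω (((‖x‖ : ℝ) : ℂ) • 1 - x) (sub_nonneg.2 (le_norm_smul_one hx))
    have h3 : ω x = ω (((‖x‖ : ℝ) : ℂ) • 1) - ω (((‖x‖ : ℝ) : ℂ) • 1 - x) := by
      rw [map_sub]; ring
    rw [h3, star_sub, (IsSelfAdjoint.of_nonneg h1).star_eq, (IsSelfAdjoint.of_nonneg h2).star_eq]
  intro x
  have hx := realPart_add_I_smul_imaginaryPart x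
  have hr := hsa _ (ℜ x).2
  have hi := hsa _ (ℑ x).2
  rw [← hx]
  simp only [star_add, star_smul, map_add, map_smul, hr, hi, (ℜ x).2.star_eq, (ℑ x).2.star_eq,
    smul_eq_mul, star_mul']

theorem IsHerm.re_realPart {φ : Functional M} (hφ : IsHerm φ) (x : M.toStarSubalgebra) :
    (φ (ℜ x : M.toStarSubalgebra)).re = (φ x).re := by
  have h : (2 : ℂ) * φ (ℜ x : M.toStarSubalgebra) = φ x + star (φ x) := by
    rw [← hφ, ← map_add, ← smul_eq_mul, ← map_smul]
    congr 1
    rw [realPart_apply_coe, ← Complex.coe_smul, smul_smul]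
    norm_num
  have := congr_arg Complex.re h
  simp at this
  linarith

/-- Rotating x by a phase makes φ x real and nonnegative, and then only the real part of x
contributes. -/
theorem IsHerm.opNorm_le {φ : Functional M} (hφ : IsHerm φ) {c : ℝ} (hc : 0 ≤ c)
    (h : ∀ y : M.toStarSubalgebra, IsSelfAdjoint y → (φ y).re ≤ c * ‖y‖) : ‖φ‖ ≤ c := by
  refine φ.opNorm_le_bound hc fun x => ?_
  obtain ⟨l, hl, hl'⟩ : ∃ l : ℂ, ‖l‖ = 1 ∧ l * φ x = ‖φ x‖ := by
    by_cases h0 : φ x = 0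
    · exact ⟨1, by simp, by simp [h0]⟩
    · have hn : (‖φ x‖ : ℂ) ≠ 0 := by simpa using h0
      refine ⟨star (φ x) / ‖φ x‖, by simp [h0], ?_⟩
      rw [div_mul_eq_mul_div, ← starRingEnd_apply, Complex.conj_mul']
      field_simp
  have h1 := h _ (ℜ (l • x)).2
  rw [hφ.re_realPart, map_smul, smul_eq_mul, hl', Complex.ofReal_re] at h1
  refine h1.trans (mul_le_mul_of_nonneg_left ?_ hc)
  refine (realPart.norm_le _).trans ?_
  exact (norm_smul l x).le.trans (by rw [hl, one_mul])

theorem IsPos.one_eq_norm {ω : Functional M} (hω : IsPos ω) : ω 1 = ‖ω‖ := by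
  have h1 : 0 ≤ ω 1 := hω 1 zero_le_one
  have h2 : ω 1 = ((ω 1).re : ℂ) := Complex.eq_re_of_ofReal_le h1
  have hre : 0 ≤ (ω 1).re := (Complex.nonneg_iff.1 h1).1
  rw [h2]
  congr 1
  refine le_antisymm ?_ (hω.isHerm.opNorm_le hre fun y hy => ?_)
  · calc (ω 1).re ≤ ‖ω 1‖ := Complex.re_le_norm _
      _ ≤ ‖ω‖ * ‖(1 : M.toStarSubalgebra)‖ := ω.le_opNorm _
      _ ≤ ‖ω‖ * 1 := by gcongr; exact norm_one_coe_le
      _ = _ := mul_one _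
  · have := (Complex.le_def.1 (hω.mono (le_norm_smul_one hy))).1
    rw [map_smul, smul_eq_mul, Complex.re_ofReal_mul, mul_comm] at this
    exact this

/-- Testing the norm on x + it·1 for all real t shows that ω is real on self-adjoint x; for x ≥ 0,
the bound ‖ ‖x‖·1 - x ‖ ≤ ‖x‖ then gives the sign. -/
theorem isPos_of_one_eq_norm {ω : Functional M} (h1 : ω 1 = ‖ω‖) : IsPos ω := by
  have him : ∀ x : M.toStarSubalgebra, IsSelfAdjoint x → (ω x).im = 0 := fun x hx => by
    have key : ∀ t : ℝ, ((ω x).im + t * ‖ω‖) ^ 2 ≤ ‖ω‖ ^ 2 * (‖x‖ ^ 2 + t ^ 2) := fun t => by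
      set y : M.toStarSubalgebra := x + ((t : ℂ) * Complex.I) • 1 with hy
      have hstar : star y * y = x * x + ((t ^ 2 : ℝ) : ℂ) • 1 := by
        simp only [hy, star_add, star_smul, hx.star_eq, star_one, add_mul, mul_add, smul_mul_assoc,
          mul_smul_comm, one_mul, mul_one, smul_add, smul_smul]
        have e1 : star ((t : ℂ) * Complex.I) = -((t : ℂ) * Complex.I) := by simp
        have e2 : (t : ℂ) * Complex.I * -((t : ℂ) * Complex.I) = ((t ^ 2 : ℝ) : ℂ) := by
          push_cast; linear_combination (-(t : ℂ) ^ 2) * Complex.I_sq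
        rw [e1, e2]
        module
      have hn : ‖y‖ ^ 2 ≤ ‖x‖ ^ 2 + t ^ 2 := by
        rw [sq, ← CStarRing.norm_star_mul_self, hstar]
        refine (norm_add_le _ _).trans (add_le_add ?_ ?_)
        · rw [sq]; exact norm_mul_le _ _
        · rw [norm_smul, Complex.norm_real, Real.norm_of_nonneg (sq_nonneg t)]
          exact mul_le_of_le_one_right (sq_nonneg t) norm_one_coe_le
      have him : (ω y).im = (ω x).im + t * ‖ω‖ := by
        rw [hy, map_add, map_smul, h1]
        simp
      rw [← him]
      calc (ω y).im ^ 2 ≤ ‖ω y‖ ^ 2 := by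
            rw [← sq_abs]; gcongr; exact Complex.abs_im_le_norm _
        _ ≤ (‖ω‖ * ‖y‖) ^ 2 := by gcongr; exact ω.le_opNorm _
        _ = ‖ω‖ ^ 2 * ‖y‖ ^ 2 := mul_pow _ _ _
        _ ≤ _ := by gcongr
    rcases eq_or_ne ‖ω‖ 0 with h0 | h0
    · rw [norm_eq_zero.1 h0]; simp
    · by_contra hb
      -- With b = Im ω x, `key` reads b² + 2bt‖ω‖ ≤ ‖ω‖²‖x‖²; this t makes bt‖ω‖ equal to the right
      -- side, which forces b = 0.
      have h2 := key (‖ω‖ * (‖x‖ ^ 2) / (ω x).im)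
      have h3 : (ω x).im * (‖ω‖ * (‖x‖ ^ 2) / (ω x).im) = ‖ω‖ * (‖x‖ ^ 2) := by field_simp
      have h4 : 0 < (ω x).im ^ 2 := by positivity
      generalize ‖ω‖ * (‖x‖ ^ 2) / (ω x).im = t at h2 h3
      have h5 : (ω x).im * t * ‖ω‖ = (‖ω‖ * ‖x‖) ^ 2 := by rw [h3]; ring
      nlinarith [sq_nonneg (‖ω‖ * ‖x‖)]
  intro x hx
  have hxs : IsSelfAdjoint x := Subtype.ext (IsSelfAdjoint.of_nonneg hx).star_eq
  refine Complex.nonneg_iff.2 ⟨?_, (him x hxs).symm⟩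
  have h2 : ‖(((‖x‖ : ℝ) : ℂ) • 1 - x : M.toStarSubalgebra)‖ ≤ ‖x‖ := by
    refine CStarAlgebra.norm_le_norm_of_nonneg_of_le (A := H →L[ℂ] H)
      (a := ((((‖x‖ : ℝ) : ℂ) • 1 - x : M.toStarSubalgebra) : H →L[ℂ] H))
      (b := ‖x‖ • (1 : H →L[ℂ] H)) ?_ ?_ |>.trans ?_
    · exact sub_nonneg.2 (le_norm_smul_one hxs)
    · exact sub_le_self _ hx
    · rw [norm_smul, norm_norm]
      exact mul_le_of_le_one_right (norm_nonneg _) ContinuousLinearMap.norm_id_le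
  have h3 := (Complex.re_le_norm _).trans ((ω.le_opNorm _).trans
    (mul_le_mul_of_nonneg_left h2 (norm_nonneg ω)))
  rw [map_sub, map_smul, h1] at h3
  rw [Complex.sub_re, smul_eq_mul, ← Complex.ofReal_mul, Complex.ofReal_re] at h3
  linarith

/-- Cauchy–Schwarz for the semi-inner product (x, y) ↦ ω(x* y). -/
theorem IsPos.apply_star_mul_eq_zero {ω : Functional M} (hω : IsPos ω) {c : M.toStarSubalgebra}
    (hc : (ω (star c * c)).re ≤ 0) (y : M.toStarSubalgebra) : ω (star c * y) = 0 := by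
  let core : PreInnerProductSpace.Core ℂ M.toStarSubalgebra :=
    { inner := fun x y => ω (star x * y)
      conj_inner_symm := fun x y => by
        have h := hω.isHerm (star y * x)
        rw [star_mul, star_star] at h
        exact h.symm
      re_inner_nonneg := fun x =>
        (Complex.nonneg_iff.1 (hω _ (star_mul_self_coe_nonneg x))).1
      add_left := fun x y z => by simp [add_mul]
      smul_left := fun x y r => by simp }
  have h := InnerProductSpace.Core.inner_mul_inner_self_le (c := core) c y
  have hy : 0 ≤ (ω (star y * y)).re := core.re_inner_nonneg y
  change ‖ω (star c * y)‖ * ‖ω (star y * c)‖ ≤ (ω (star c * c)).re * (ω (star y * y)).re at h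
  have hs : ‖ω (star y * c)‖ = ‖ω (star c * y)‖ := by
    have := hω.isHerm (star c * y)
    rw [star_mul, star_star] at this
    rw [this, norm_star]
  rw [hs] at h
  have h2 : ‖ω (star c * y)‖ * ‖ω (star c * y)‖ ≤ 0 :=
    h.trans (mul_nonpos_of_nonpos_of_nonneg hc hy)
  exact norm_eq_zero.1 (mul_self_eq_zero.1 (le_antisymm h2 (mul_self_nonneg _)))

theorem IsPos.apply_mul_eq_zero_of_proj {ω : Functional M} (hω : IsPos ω) {q : M.toStarSubalgebra}
    (hq : IsStarProjection q) (h0 : (ω q).re ≤ 0) (y : M.toStarSubalgebra) :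
    ω (q * y) = 0 ∧ ω (y * q) = 0 := by
  have h : ∀ y, ω (q * y) = 0 := fun y => by
    have := hω.apply_star_mul_eq_zero (c := q) (by
      rwa [hq.isSelfAdjoint.star_eq, hq.isIdempotentElem.eq]) y
    rwa [hq.isSelfAdjoint.star_eq] at this
  refine ⟨h y, ?_⟩
  have h1 := hω.isHerm (q * star y)
  rw [h, star_mul, star_star, hq.isSelfAdjoint.star_eq, star_zero] at h1
  exact h1

/-- Since w*w ≤ 1, ω((1-w)*(1-w)) ≤ 0, so 1 - w is null for ω. This gives uniqueness of the absolute
value. -/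
theorem IsPos.apply_mul_eq_of_norm_le_one {ω : Functional M} (hω : IsPos ω)
    {w : M.toStarSubalgebra} (hw : ‖w‖ ≤ 1) (h : ω (star w) = ω 1) (y : M.toStarSubalgebra) :
    ω (star w * y) = ω y := by
  have h1 : ω w = ω 1 := by
    have := hω.isHerm (star w)
    rw [star_star, h] at this
    rw [this, ← hω.isHerm, star_one]
  have hle : ω (star w * w) ≤ ω 1 := by
    refine hω.mono ?_
    refine (CStarAlgebra.norm_le_one_iff_of_nonneg (star (w : H →L[ℂ] H) * (w : H →L[ℂ] H))
      (star_mul_self_nonneg _)).1 ?_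
    rw [CStarRing.norm_star_mul_self]
    exact mul_le_one₀ hw (norm_nonneg _) hw
  have h2 := hω.apply_star_mul_eq_zero (c := 1 - w) (by
    have e : star (1 - w) * (1 - w) = 1 - w - star w + star w * w := by
      simp only [star_sub, star_one]; noncomm_ring
    rw [e, map_add, map_sub, map_sub, h, h1]
    have := (Complex.le_def.1 hle).1
    simp
    linarith) y
  rw [star_sub, star_one, sub_mul, one_mul, map_sub, sub_eq_zero] at h2
  exact h2.symm

theorem IsPos.add {φ ψ : Functional M} (hφ : IsPos φ) (hψ : IsPos ψ) : IsPos (φ + ψ) :=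
  fun x hx => add_nonneg (hφ x hx) (hψ x hx)

theorem IsPos.smul {φ : Functional M} (hφ : IsPos φ) {c : ℂ} (hc : 0 ≤ c) : IsPos (c • φ) :=
  fun x hx => mul_nonneg hc (hφ x hx)

theorem IsPos.compression {φ : Functional M} (hφ : IsPos φ) (c : M.toStarSubalgebra) :
    IsPos (compression (star c) c φ) := fun x hx => by
  refine hφ _ ?_
  have := star_left_conjugate_nonneg hx (c : H →L[ℂ] H)
  rwa [mul_assoc] at this

theorem isPos_vectorFunctional (ξ : H) : IsPos (vectorFunctional M ξ) :=
  fun _ hx => nonneg_iff_inner.1 hx ξ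

theorem IsHerm.add {φ ψ : Functional M} (hφ : IsHerm φ) (hψ : IsHerm ψ) : IsHerm (φ + ψ) :=
  fun x => by simp [hφ x, hψ x]

theorem IsHerm.sub {φ ψ : Functional M} (hφ : IsHerm φ) (hψ : IsHerm ψ) : IsHerm (φ - ψ) :=
  fun x => by simp [hφ x, hψ x]

theorem IsHerm.smul {φ : Functional M} (hφ : IsHerm φ) {c : ℂ} (hc : IsSelfAdjoint c) :
    IsHerm (c • φ) :=
  fun x => by simp only [smul_apply, hφ x, star_smul, hc.star_eq]

end Positive

/-! ### A projection maximizing a normal functional over the positive contractions. -/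

section Maximizer

variable {H : Type*} [NormedAddCommGroup H] [InnerProductSpace ℂ H] [CompleteSpace H]
  {M : VonNeumannAlgebra H}

omit [CompleteSpace H] in
theorem starProjection_apply_congr {K L : Submodule ℂ H} [K.HasOrthogonalProjection]
    [L.HasOrthogonalProjection] (h : K = L) (b : H) :
    K.starProjection b = L.starProjection b := by
  subst h; rfl

/-- The projection onto the kernel of an element of a von Neumann algebra belongs to it. -/
theorem starProjection_ker_mem {T : H →L[ℂ] H} (hT : T ∈ M) :
    (T.ker).starProjection ∈ M := by
  rw [IsStarProjection.mem_iff isStarProjection_starProjection]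
  intro y hy
  rw [Submodule.range_starProjection, Module.End.mem_invtSubmodule_iff_forall_mem_of_mem]
  intro x hx
  have h : T * y = y * T := mem_commutant_iff.1 hy T hT
  have h2 : T (y x) = y (T x) := congr($h x)
  have hx' : T x = 0 := hx
  change T (y x) = 0
  rw [h2, hx', map_zero]

/-- The positive contractions of `M`. -/
def effects (M : VonNeumannAlgebra H) : Set M.toStarSubalgebra :=
  {x | 0 ≤ (x : H →L[ℂ] H) ∧ (x : H →L[ℂ] H) ≤ 1}

theorem norm_le_one_of_mem_effects {x : M.toStarSubalgebra} (hx : x ∈ effects M) : ‖x‖ ≤ 1 :=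
  (CStarAlgebra.norm_le_one_iff_of_nonneg (x : H →L[ℂ] H) hx.1).2 hx.2

theorem norm_pow_le_one_of_norm_le_one {x : M.toStarSubalgebra} (hx : ‖x‖ ≤ 1) (n : ℕ) :
    ‖x ^ n‖ ≤ 1 := by
  rcases n.eq_zero_or_pos with rfl | hn
  · exact norm_one_coe_le
  · exact (norm_pow_le' x hn).trans (pow_le_one₀ (norm_nonneg x) hx)

theorem _root_.IsStarProjection.mem_effects {p : M.toStarSubalgebra} (hp : IsStarProjection p) :
    p ∈ effects M := by
  have h : IsStarProjection (p : H →L[ℂ] H) :=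
    ⟨congr_arg Subtype.val hp.isIdempotentElem.eq, congr_arg Subtype.val hp.isSelfAdjoint.star_eq⟩
  exact ⟨h.nonneg, h.le_one⟩

/-- Weak compactness: an ultrafilter limit of a maximizing sequence stays in `effects M`. -/
theorem IsNormal.exists_isMaxOn_effects {φ : Functional M} (hφ : IsNormal φ) :
    ∃ e ∈ effects M, ∀ x ∈ effects M, (φ x).re ≤ (φ e).re := by
  have hbdd : BddAbove ((fun x => (φ x).re) '' effects M) := by
    refine ⟨‖φ‖, ?_⟩
    rintro _ ⟨x, hx, rfl⟩
    exact (Complex.re_le_norm _).trans (φ.unit_le_opNorm x (norm_le_one_of_mem_effects hx))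
  have hne : ((fun x => (φ x).re) '' effects M).Nonempty :=
    ⟨_, 0, ⟨le_rfl, zero_le_one⟩, rfl⟩
  obtain ⟨r, -, hr, hmem⟩ := exists_seq_tendsto_sSup hne hbdd
  choose x hx hxr using hmem
  obtain ⟨z, hz⟩ := exists_weak_limit (hyperfilter ℕ) (fun n => (x n : H →L[ℂ] H)) (C := 1)
    (fun n => norm_le_one_of_mem_effects (hx n))
  have hzM : z ∈ M := mem_of_weak_limit (fun n => (x n).2) hz
  have hz0 : 0 ≤ z := nonneg_of_weak_limit (fun n => (hx n).1) hz
  have hz1 : 0 ≤ 1 - z := nonneg_of_weak_limit (e := fun n => 1 - (x n : H →L[ℂ] H))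
    (fun n => sub_nonneg.2 (hx n).2) (fun a b => by
      simpa [inner_sub_right] using (hz a b).const_sub ⟪a, b⟫_ℂ)
  refine ⟨⟨z, hzM⟩, ⟨hz0, sub_nonneg.1 hz1⟩, fun y hy => ?_⟩
  have hlim := hφ.tendsto (z := ⟨z, hzM⟩) (fun n => norm_le_one_of_mem_effects (hx n)) hz
  have hre := (Complex.continuous_re.tendsto _).comp hlim
  have hr' : Tendsto r (hyperfilter ℕ : Filter ℕ) _ :=
    hr.mono_left (Nat.hyperfilter_le_atTop)
  have heq := tendsto_nhds_unique hre (hr'.congr fun n => (hxr n).symm)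
  rw [heq]
  exact le_csSup hbdd ⟨y, hy, rfl⟩

/-- Both e ± eᵏ⁺¹(1 - e) are positive contractions, so maximality at e forces Re φ(eᵏ⁺¹ - eᵏ⁺²) = 0.
-/
theorem re_apply_pow_eq {φ : Functional M} {e : M.toStarSubalgebra} (he : e ∈ effects M)
    (hmax : ∀ x ∈ effects M, (φ x).re ≤ (φ e).re) (k : ℕ) :
    (φ (e ^ (k + 1))).re = (φ e).re := by
  induction k with
  | zero => simp
  | succ k ih =>
    rw [← ih]
    have hpow : ∀ n : ℕ, 0 ≤ (e : H →L[ℂ] H) ^ n := fun n => CStarAlgebra.pow_nonneg he.1 n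
    have hpow1 : ∀ n : ℕ, 0 ≤ 1 - (e : H →L[ℂ] H) ^ n := by
      intro n
      rw [sub_nonneg, ← CStarAlgebra.norm_le_one_iff_of_nonneg _ (hpow n)]
      exact norm_pow_le_one_of_norm_le_one (norm_le_one_of_mem_effects he) n
    have h1 : 0 ≤ 1 - (e : H →L[ℂ] H) := sub_nonneg.2 he.2
    have hd : 0 ≤ (e : H →L[ℂ] H) ^ (k + 1) * (1 - e) :=
      Commute.mul_nonneg (hpow _) h1 ((Commute.one_right _).sub_right ((Commute.refl _).pow_left _))
    have hplus := hmax (e + e ^ (k + 1) * (1 - e)) ⟨add_nonneg he.1 hd, by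
      have h : 0 ≤ (1 - (e : H →L[ℂ] H) ^ (k + 1)) * (1 - e) :=
        Commute.mul_nonneg (hpow1 _) h1 ((Commute.one_right _).sub_right
          ((Commute.one_left _).sub_left ((Commute.refl _).pow_left _)))
      rw [sub_mul, one_mul, sub_sub, sub_nonneg] at h
      exact h⟩
    have hminus := hmax (e - e ^ (k + 1) * (1 - e)) ⟨by
      have h : 0 ≤ (e : H →L[ℂ] H) * (1 - (e : H →L[ℂ] H) ^ k) + (e : H →L[ℂ] H) ^ (k + 2) :=
        add_nonneg (Commute.mul_nonneg he.1 (hpow1 _)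
          ((Commute.one_right _).sub_right ((Commute.refl _).pow_right _))) (hpow _)
      have h' : (e : H →L[ℂ] H) * (1 - (e : H →L[ℂ] H) ^ k) + (e : H →L[ℂ] H) ^ (k + 2) =
          e - (e : H →L[ℂ] H) ^ (k + 1) * (1 - e) := by
        rw [mul_sub, mul_sub, ← pow_succ', ← pow_succ, mul_one, mul_one]
        exact sub_add _ _ _
      rw [h'] at h
      exact h, (sub_le_self _ hd).trans he.2⟩
    have hexp : e ^ (k + 1) * (1 - e) = e ^ (k + 1) - e ^ (k + 1 + 1) := by
      rw [mul_sub, mul_one, ← pow_succ]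
    rw [hexp, map_add, map_sub, Complex.add_re, Complex.sub_re] at hplus
    rw [hexp, map_sub, map_sub, Complex.sub_re, Complex.sub_re] at hminus
    linarith

theorem IsNormal.exists_isStarProjection_isMaxOn_effects {φ : Functional M} (hφ : IsNormal φ) :
    ∃ p : M.toStarSubalgebra, IsStarProjection p ∧ ∀ x ∈ effects M, (φ x).re ≤ (φ p).re := by
  obtain ⟨e, he, hmax⟩ := hφ.exists_isMaxOn_effects
  set T : H →L[ℂ] H := (e : H →L[ℂ] H) with hT
  have hTM : 1 - T ∈ M := sub_mem (one_mem M) e.2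
  set p := (1 - T).ker.starProjection with hp
  have hTp : ∀ b, T (p b) = p b := fun b => by
    have h : p b ∈ (1 - T).ker := Submodule.starProjection_apply_mem _ b
    have h' : p b - T (p b) = 0 := h
    exact (sub_eq_zero.1 h').symm
  have hproj : IsStarProjection p := isStarProjection_starProjection
  refine ⟨⟨p, starProjection_ker_mem hTM⟩,
    ⟨Subtype.ext hproj.isIdempotentElem.eq, Subtype.ext hproj.isSelfAdjoint.star_eq⟩,
    fun x hx => (hmax x hx).trans_eq ?_⟩
  -- Cesàro means of the powers of e. The extra factor e removes e⁰, at which φ need not be maximal;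
  -- it does not change the limit p because `T` fixes the range of p.
  let y : ℕ → M.toStarSubalgebra := fun n =>
    ((n : ℂ)⁻¹) • (e * ∑ k ∈ Finset.range n, e ^ k)
  have hTnorm : ‖T‖ ≤ 1 := norm_le_one_of_mem_effects he
  have hynorm : ∀ n, ‖y n‖ ≤ 1 := fun n => by
    have hpow : ∀ k : ℕ, ‖e ^ k‖ ≤ 1 := norm_pow_le_one_of_norm_le_one hTnorm
    calc ‖y n‖ = (n : ℝ)⁻¹ * ‖e * ∑ k ∈ Finset.range n, e ^ k‖ := by
          rw [norm_smul, norm_inv, Complex.norm_natCast]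
      _ ≤ (n : ℝ)⁻¹ * (1 * ∑ k ∈ Finset.range n, (1 : ℝ)) := by
          gcongr
          refine (norm_mul_le _ _).trans ?_
          gcongr
          · exact hTnorm
          · exact norm_sum_le_of_le _ fun k _ => hpow k
      _ ≤ 1 := by simpa using inv_mul_le_one
  have hlim : Tendsto (fun n => φ (y n)) atTop (𝓝 (φ ⟨p, starProjection_ker_mem hTM⟩)) := by
    refine hφ.tendsto hynorm fun a b => ?_
    have h1 : Tendsto (fun n => birkhoffAverage ℂ T id n b) atTop (𝓝 (p b)) := by
      convert! T.tendsto_birkhoffAverage_orthogonalProjection hTnorm b using 2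
      refine starProjection_apply_congr ?_ b
      ext v
      change v - T v = 0 ↔ T v = v
      rw [sub_eq_zero, eq_comm]
    have h2 := ((innerSL ℂ a).continuous.tendsto _).comp ((T.continuous.tendsto _).comp h1)
    rw [hTp, innerSL_apply_apply] at h2
    refine h2.congr fun n => ?_
    simp [y, birkhoffAverage, birkhoffSum, ← hT]
  have hre := (Complex.continuous_re.tendsto _).comp hlim
  refine tendsto_nhds_unique (tendsto_const_nhds.congr' ?_) hre
  filter_upwards [eventually_ne_atTop 0] with n hn
  have hn' : (n : ℝ) ≠ 0 := by exact_mod_cast hn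
  have hφy : φ (y n) = (((n : ℝ)⁻¹ : ℝ) : ℂ) * ∑ k ∈ Finset.range n, φ (e ^ (k + 1)) := by
    simp only [y]
    rw [map_smul, smul_eq_mul, Finset.mul_sum, map_sum]
    simp_rw [← pow_succ']
    simp
  rw [Function.comp, hφy, Complex.re_ofReal_mul, Complex.re_sum]
  simp_rw [re_apply_pow_eq he hmax]
  simp [hn']

end Maximizer

/-! ### Jordan and polar decompositions: existence and uniqueness. -/

section Jordan

variable {H : Type*} [NormedAddCommGroup H] [InnerProductSpace ℂ H] [CompleteSpace H]
  {M : VonNeumannAlgebra H}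

/-- `φ = φ₁ - φ₂` with positive normal `φ₁` supported under the projection `p` and positive normal
`φ₂` supported under `1 - p`. -/
structure IsOrthogonalDecomposition (φ φ₁ φ₂ : Functional M) (p : M.toStarSubalgebra) : Prop where
  left_mem : φ₁ ∈ posNormal M
  right_mem : φ₂ ∈ posNormal M
  eq_sub : φ = φ₁ - φ₂
  isStarProjection : IsStarProjection p
  left_eq_zero : φ₁ (1 - p) = 0
  right_eq_zero : φ₂ p = 0

theorem _root_.IsStarProjection.two_mul_sub_one_isSelfAdjoint {p : M.toStarSubalgebra}
    (hp : IsStarProjection p) : IsSelfAdjoint (p - (1 - p)) :=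
  hp.isSelfAdjoint.sub hp.one_sub.isSelfAdjoint

theorem _root_.IsStarProjection.two_mul_sub_one_mul_self {p : M.toStarSubalgebra}
    (hp : IsStarProjection p) : (p - (1 - p)) * (p - (1 - p)) = 1 := by
  have h := hp.isIdempotentElem.eq
  have : (p - (1 - p)) * (p - (1 - p)) = p * p + p * p + p * p + p * p - p - p - p - p + 1 := by
    noncomm_ring
  rw [this, h]
  abel

theorem _root_.IsStarProjection.norm_two_mul_sub_one_le {p : M.toStarSubalgebra}
    (hp : IsStarProjection p) : ‖p - (1 - p)‖ ≤ 1 := by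
  have h := CStarRing.norm_star_mul_self (x := p - (1 - p))
  rw [hp.two_mul_sub_one_isSelfAdjoint.star_eq, hp.two_mul_sub_one_mul_self] at h
  have h1 : ‖(1 : M.toStarSubalgebra)‖ ≤ 1 := norm_one_coe_le
  by_contra! hc
  nlinarith

namespace IsOrthogonalDecomposition

variable {φ φ₁ φ₂ : Functional M} {p : M.toStarSubalgebra}

theorem apply_two_mul_sub_one (h : IsOrthogonalDecomposition φ φ₁ φ₂ p) :
    φ (p - (1 - p)) = φ₁ 1 + φ₂ 1 := by
  have h1 := h.left_eq_zero
  have h2 := h.right_eq_zero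
  rw [map_sub] at h1
  rw [h.eq_sub]
  simp only [sub_apply, map_sub]
  linear_combination (-2 : ℂ) * h1 - (2 : ℂ) * h2

theorem norm_eq (h : IsOrthogonalDecomposition φ φ₁ φ₂ p) : ‖φ‖ = ‖φ₁‖ + ‖φ₂‖ := by
  refine le_antisymm (h.eq_sub ▸ norm_sub_le _ _) ?_
  have h1 := h.apply_two_mul_sub_one
  rw [h.left_mem.2.one_eq_norm, h.right_mem.2.one_eq_norm, ← Complex.ofReal_add] at h1
  have h2 := φ.unit_le_opNorm _ h.isStarProjection.norm_two_mul_sub_one_le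
  rw [h1, Complex.norm_real] at h2
  exact (le_abs_self _).trans h2

theorem isJordanDecomposition (h : IsOrthogonalDecomposition φ φ₁ φ₂ p) :
    IsJordanDecomposition φ φ₁ φ₂ :=
  ⟨h.left_mem, h.right_mem, h.eq_sub, h.norm_eq⟩

/-- Thus φ and p alone determine φ₁, which is what uniqueness needs. -/
theorem left_apply (h : IsOrthogonalDecomposition φ φ₁ φ₂ p) (x : M.toStarSubalgebra) :
    φ₁ x = φ (x * p) := by
  have h1 := (h.left_mem.2.apply_mul_eq_zero_of_proj h.isStarProjection.one_sub
    (by simp [h.left_eq_zero]) x).2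
  have h2 := (h.right_mem.2.apply_mul_eq_zero_of_proj h.isStarProjection
    (by simp [h.right_eq_zero]) x).2
  rw [mul_sub, mul_one, map_sub] at h1
  rw [h.eq_sub, sub_apply]
  linear_combination h1 + h2

/-- Evaluating φ at 2p - 1, norm additivity forces ψ₁(1-p) + ψ₂(p) = 0 with both terms nonnegative,
so ψ₁, ψ₂ are orthogonal through the same p. -/
theorem eq_of_isJordanDecomposition (h : IsOrthogonalDecomposition φ φ₁ φ₂ p)
    {ψ₁ ψ₂ : Functional M} (hψ : IsJordanDecomposition φ ψ₁ ψ₂) : ψ₁ = φ₁ := by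
  obtain ⟨⟨hn1, h1⟩, ⟨hn2, h2⟩, heq, hnorm⟩ := hψ
  have hp := h.isStarProjection
  have hu := h.apply_two_mul_sub_one
  rw [h.left_mem.2.one_eq_norm, h.right_mem.2.one_eq_norm, ← Complex.ofReal_add, ← h.norm_eq, hnorm,
    Complex.ofReal_add, ← h1.one_eq_norm, ← h2.one_eq_norm, heq] at hu
  simp only [sub_apply, map_sub] at hu
  have hq1 : 0 ≤ ψ₁ (1 - p) := h1 _ hp.one_sub.mem_effects.1
  have hp2 : 0 ≤ ψ₂ p := h2 _ hp.mem_effects.1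
  have hsum : ψ₁ (1 - p) + ψ₂ p = 0 := by
    rw [map_sub]; linear_combination (-1 / 2 : ℂ) * hu
  have hq1' : ψ₁ (1 - p) = 0 := le_antisymm (by
    rw [eq_neg_of_add_eq_zero_left hsum]; exact neg_nonpos.2 hp2) hq1
  have hp2' : ψ₂ p = 0 := by rw [hq1', zero_add] at hsum; exact hsum
  have hψ' : IsOrthogonalDecomposition φ ψ₁ ψ₂ p := 
    ⟨⟨hn1, h1⟩, ⟨hn2, h2⟩, heq, hp, hq1', hp2'⟩
  ext x
  rw [hψ'.left_apply, h.left_apply]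

theorem posPart_eq (h : IsOrthogonalDecomposition φ φ₁ φ₂ p) : posPart φ = φ₁ := by
  obtain ⟨ψ₂, hψ⟩ := Classical.epsilon_spec
    (p := fun φ₁ => ∃ φ₂, IsJordanDecomposition φ φ₁ φ₂) ⟨φ₁, φ₂, h.isJordanDecomposition⟩
  exact h.eq_of_isJordanDecomposition hψ

theorem apply_two_mul_sub_one_mul (h : IsOrthogonalDecomposition φ φ₁ φ₂ p)
    (x : M.toStarSubalgebra) : φ ((p - (1 - p)) * x) = (φ₁ + φ₂) x := by
  have h1 := (h.left_mem.2.apply_mul_eq_zero_of_proj h.isStarProjection.one_sub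
    (by simp [h.left_eq_zero]) x).1
  have h2 := (h.right_mem.2.apply_mul_eq_zero_of_proj h.isStarProjection
    (by simp [h.right_eq_zero]) x).1
  rw [sub_mul, one_mul, map_sub] at h1
  rw [h.eq_sub]
  simp only [sub_apply, add_apply, sub_mul, one_mul, map_sub]
  linear_combination (-2 : ℂ) * h1 - (2 : ℂ) * h2

theorem isPolarDecomposition (h : IsOrthogonalDecomposition φ φ₁ φ₂ p) :
    IsPolarDecomposition φ (p - (1 - p)) (φ₁ + φ₂) := by
  have hs := h.isStarProjection.two_mul_sub_one_isSelfAdjoint.star_eq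
  have hm := h.isStarProjection.two_mul_sub_one_mul_self
  refine ⟨⟨h.left_mem.1.add h.right_mem.1, h.left_mem.2.add h.right_mem.2⟩, ?_, fun y => ?_,
    fun y => ?_⟩
  · rw [hs, hm, one_mul]
  · rw [← h.apply_two_mul_sub_one_mul, ← mul_assoc, hm, one_mul]
  · rw [hs, h.apply_two_mul_sub_one_mul]

/-- With w = vu*, a contraction, ρ = ω(w* ·); both functionals have norm ‖φ‖, so ω(w*) = ω(1) and w*
acts trivially. -/
theorem eq_of_isPolarDecomposition (h : IsOrthogonalDecomposition φ φ₁ φ₂ p)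
    {v : M.toStarSubalgebra} {ρ : Functional M} (hρ : IsPolarDecomposition φ v ρ) :
    ρ = φ₁ + φ₂ := by
  obtain ⟨⟨-, hpos⟩, hv, hφρ, hρφ⟩ := hρ
  obtain ⟨⟨-, hω⟩, -, hφω, hωφ⟩ := h.isPolarDecomposition
  set u := p - (1 - p) with hu
  set ω := φ₁ + φ₂
  have hu1 : ‖u‖ ≤ 1 := h.isStarProjection.norm_two_mul_sub_one_le
  have hv1 : ‖v‖ ≤ 1 := by
    have hP : IsStarProjection (star v * v) :=
      ⟨by rw [IsIdempotentElem, mul_assoc, ← mul_assoc v, hv], IsSelfAdjoint.star_mul_self v⟩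
    have := hP.norm_le
    rw [CStarRing.norm_star_mul_self] at this
    by_contra! hc
    nlinarith
  have hsv1 : ‖star v‖ ≤ 1 := by rwa [norm_star]
  have hω1 : ‖ω‖ = ‖φ‖ := by
    have : ω 1 = φ₁ 1 + φ₂ 1 := rfl
    rw [hω.one_eq_norm, h.left_mem.2.one_eq_norm, h.right_mem.2.one_eq_norm] at this
    rw [h.norm_eq]
    exact_mod_cast this
  have hρ1 : ‖ρ‖ = ‖φ‖ := by
    refine le_antisymm ?_ (φ.opNorm_le_bound (norm_nonneg _) fun y => ?_)
    · have h1 := φ.unit_le_opNorm _ hsv1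
      rw [← mul_one (star v), ← hρφ, hpos.one_eq_norm, Complex.norm_real, norm_norm] at h1
      exact h1
    · rw [hφρ]
      refine (ρ.le_opNorm _).trans ?_
      gcongr
      exact (norm_mul_le _ _).trans (mul_le_of_le_one_left (norm_nonneg _) hv1)
  have hstar : star (v * star u) = u * star v := by rw [star_mul, star_star]
  have hρω : ∀ y, ρ y = ω (star (v * star u) * y) := fun y => by
    rw [hρφ, hφω, hstar, mul_assoc]
  ext y
  rw [hρω]
  refine hω.apply_mul_eq_of_norm_le_one ?_ ?_ y
  · refine (norm_mul_le _ _).trans (mul_le_one₀ hv1 (norm_nonneg _) ?_)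
    rwa [norm_star]
  · rw [← mul_one (star (v * star u)), ← hρω, hpos.one_eq_norm, hω.one_eq_norm, hρ1, hω1]

theorem absVal_eq (h : IsOrthogonalDecomposition φ φ₁ φ₂ p) : absVal φ = φ₁ + φ₂ := by
  obtain ⟨v, hv⟩ := Classical.epsilon_spec
    (p := fun ω => ∃ u, IsPolarDecomposition φ u ω) ⟨_, _, h.isPolarDecomposition⟩
  exact h.eq_of_isPolarDecomposition hv

end IsOrthogonalDecomposition

theorem smul_add_mem_effects {y : M.toStarSubalgebra} (hy : IsSelfAdjoint y) (hn : 0 < ‖y‖) :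
    (((2 * ‖y‖)⁻¹ : ℝ) : ℂ) • (((‖y‖ : ℝ) : ℂ) • 1 + y) ∈ effects M := by
  have hle := le_norm_smul_one hy
  have hge := le_norm_smul_one hy.neg
  rw [norm_neg] at hge
  have hc : 0 ≤ (2 * ‖y‖)⁻¹ := by positivity
  constructor
  · have : (0 : H →L[ℂ] H) ≤ (2 * ‖y‖)⁻¹ • (‖y‖ • 1 + (y : H →L[ℂ] H)) :=
      smul_nonneg hc (neg_le_iff_add_nonneg.1 hge)
    exact this
  · have : (2 * ‖y‖)⁻¹ • (‖y‖ • 1 + (y : H →L[ℂ] H)) ≤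
        (2 * ‖y‖)⁻¹ • (‖y‖ • 1 + ‖y‖ • (1 : H →L[ℂ] H)) :=
      smul_le_smul_of_nonneg_left (add_le_add_right hle _) hc
    refine (show _ ≤ _ from this).trans_eq ?_
    rw [← add_smul, smul_smul, ← two_mul, inv_mul_cancel₀ (by positivity), one_smul]

/-- Apply maximality to (‖y‖·1 + y)/(2‖y‖) for self-adjoint y ≠ 0. -/
theorem norm_le_re_of_isMaxOn_effects {φ : Functional M} (hφ : IsHerm φ) {p : M.toStarSubalgebra}
    (hmax : ∀ x ∈ effects M, (φ x).re ≤ (φ p).re) : ‖φ‖ ≤ (φ (p - (1 - p))).re := by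
  have h0 := hmax 0 ⟨le_rfl, zero_le_one⟩
  have h1 := hmax 1 ⟨zero_le_one, le_rfl⟩
  simp only [map_zero, Complex.zero_re] at h0
  simp only [map_sub, Complex.sub_re]
  refine hφ.opNorm_le (by linarith) fun y hy => ?_
  rcases eq_or_ne y 0 with rfl | hy0
  · simp
  have hn : 0 < ‖y‖ := norm_pos_iff.2 hy0
  have hmem := smul_add_mem_effects hy hn
  have h2 := hmax _ hmem
  rw [map_smul, map_add, map_smul, smul_eq_mul, Complex.re_ofReal_mul, Complex.add_re, smul_eq_mul,
    Complex.re_ofReal_mul, inv_mul_le_iff₀ (by positivity)] at h2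
  linarith

theorem exists_isOrthogonalDecomposition {φ : Functional M} (hφ : φ ∈ hermNormal M) :
    ∃ φ₁ φ₂ p, IsOrthogonalDecomposition φ φ₁ φ₂ p := by
  obtain ⟨hn, hh⟩ := hφ
  obtain ⟨p, hp, hmax⟩ := hn.exists_isStarProjection_isMaxOn_effects
  have hs := hp.two_mul_sub_one_isSelfAdjoint
  have hu1 := hp.norm_two_mul_sub_one_le
  have hle := norm_le_re_of_isMaxOn_effects hh hmax
  set ω := compression (p - (1 - p)) 1 φ with hωdef
  have hωa : ∀ x, ω x = φ ((p - (1 - p)) * x) := fun x => by simp [hωdef]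
  have hreal : φ (p - (1 - p)) = ((φ (p - (1 - p))).re : ℂ) := by
    have := hh (p - (1 - p))
    rw [hs.star_eq] at this
    exact (Complex.conj_eq_iff_re.1 this.symm).symm
  have hω : IsPos ω := by
    have h1 : ‖ω‖ ≤ ‖φ‖ := ω.opNorm_le_bound (norm_nonneg _) fun x => by
      rw [hωa]
      refine (φ.le_opNorm _).trans ?_
      gcongr
      exact (norm_mul_le _ _).trans (mul_le_of_le_one_left (norm_nonneg _) hu1)
    have h2 : ω 1 = φ (p - (1 - p)) := by rw [hωa, mul_one]
    have h3 : (ω 1).re ≤ ‖ω‖ :=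
      (Complex.re_le_norm _).trans (ω.unit_le_opNorm _ norm_one_coe_le)
    refine isPos_of_one_eq_norm ?_
    rw [h2, hreal]
    rw [h2] at h3
    congr 1
    linarith
  -- As φ and φ((2p-1) ·) are both hermitian, 2p - 1, hence p, can be moved across φ.
  have hcomm : ∀ x, φ (p * x) = φ (x * p) := fun x => by
    have h1 := hω.isHerm (star x)
    rw [star_star, hωa, hωa, ← hh, star_mul, star_star, hs.star_eq] at h1
    simp only [sub_mul, mul_sub, one_mul, mul_one, map_sub] at h1
    linear_combination (1 / 2 : ℂ) * h1
  have hpp := hp.isIdempotentElem.eq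
  have hup : (p - (1 - p)) * p = p := by
    simp only [sub_mul, one_mul, hpp]; abel
  have hq := hp.one_sub
  have huq : (p - (1 - p)) * (1 - p) = -(1 - p) := by
    rw [sub_mul, hp.mul_one_sub_self, hq.isIdempotentElem.eq, zero_sub]
  refine ⟨compression p 1 φ, compression (1 - p) 1 (-φ), p, ⟨hn.compression _ _, ?_⟩,
    ⟨hn.neg.compression _ _, ?_⟩, ?_, hp, ?_, ?_⟩
  · have h := hω.compression p
    have e : compression p 1 φ = compression (star p) p ω := by
      ext x
      rw [compression_apply, compression_apply, hωa, hp.isSelfAdjoint.star_eq, 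
        ← mul_assoc (p - (1 - p)), hup, mul_one, hcomm (x * p), mul_assoc, hpp, hcomm]
    rwa [e]
  · have h := hω.compression (1 - p)
    have e : compression (1 - p) 1 (-φ) = compression (star (1 - p)) (1 - p) ω := by
      ext x
      rw [compression_apply, compression_apply, hωa, hq.isSelfAdjoint.star_eq,
        ← mul_assoc (p - (1 - p)), huq, mul_one, neg_mul, map_neg, neg_apply]
      have h1 := hcomm (x * p)
      rw [mul_assoc, hpp] at h1
      simp only [mul_sub, sub_mul, one_mul, mul_one, map_sub]
      rw [h1]
      ring
    rwa [e]
  · ext x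
    simp [sub_mul]
  · rw [compression_apply, mul_one, hp.mul_one_sub_self, map_zero]
  · rw [compression_apply, mul_one, hp.one_sub_mul_self, map_zero]

end Jordan

/-! ### Central elements and compressions by projections. -/

section Center

open ComplexStarModule

variable {H : Type*} [NormedAddCommGroup H] [InnerProductSpace ℂ H] [CompleteSpace H]
  {M : VonNeumannAlgebra H}

omit [CompleteSpace H] in
theorem two_mul_sub_identities {p P N T : H →L[ℂ] H} (hpp : p * p = p)
    (hpP : p * P = P) (hPp : P * p = P) (hpN : p * N = 0) (hNp : N * p = 0)
    (hT : T + T = P - N + 1) :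
    (1 - p) * (T + T) * (1 - p) + P = T + T - p ∧
      p * ((1 - T) + (1 - T)) * p + N = 1 - (T + T - p) := by
  have e : (1 - T) + (1 - T) = 1 + 1 - (T + T) := by abel
  rw [e, hT]
  constructor
  · simp only [sub_mul, mul_sub, mul_add, add_mul, one_mul, mul_one, hpN, hpP, hPp, hNp, hpp,
      zero_mul]
    abel
  · simp only [sub_mul, mul_sub, mul_add, add_mul, mul_one, hpN, hpP, hPp, hpp, zero_mul]
    abel

theorem nonneg_and_le_one_of_pos_neg_parts {p P N T : H →L[ℂ] H} (hpp : p * p = p)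
    (hps : star p = p) (hP : 0 ≤ P) (hN : 0 ≤ N) (hpP : p * P = P) (hPp : P * p = P)
    (hpN : p * N = 0) (hNp : N * p = 0) (hT0 : 0 ≤ T) (hT1 : T ≤ 1) (hT : T + T = P - N + 1) :
    0 ≤ T + T - p ∧ T + T - p ≤ 1 := by
  obtain ⟨e1, e2⟩ := two_mul_sub_identities hpp hpP hPp hpN hNp hT
  have h1 := star_left_conjugate_nonneg (add_nonneg hT0 hT0) (1 - p)
  have h2 := star_left_conjugate_nonneg (add_nonneg (sub_nonneg.2 hT1) (sub_nonneg.2 hT1)) p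
  rw [star_sub, star_one, hps] at h1
  rw [hps] at h2
  constructor
  · rw [← e1]
    exact add_nonneg h1 hP
  · rw [← sub_nonneg, ← e2]
    exact add_nonneg h2 hN

/-- Every positive contraction is half the sum of a projection and a positive contraction. -/
theorem exists_isStarProjection_two_smul_sub_mem_effects {x : M.toStarSubalgebra}
    (hx : x ∈ effects M) :
    ∃ p : M.toStarSubalgebra, IsStarProjection p ∧ (2 : ℂ) • x - p ∈ effects M := by
  set T : H →L[ℂ] H := (x : H →L[ℂ] H) with hT
  set y : H →L[ℂ] H := T + T - 1 with hy
  have hTsa : IsSelfAdjoint T := .of_nonneg hx.1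
  have hysa : IsSelfAdjoint y := (hTsa.add hTsa).sub (.one _)
  have hneg : y⁻ ∈ M := by
    rw [← M.commutant_commutant, mem_commutant_iff]
    intro g hg
    have hgT : Commute T g := mem_commutant_iff.1 hg T x.2
    have hgy : Commute y g := (hgT.add_left hgT).sub_left (Commute.one_left _)
    rw [CFC.negPart_def]
    exact (hgy.cfcₙ_real _).symm
  -- The spectral projection of 2x - 1 for [0, ∞), written as a kernel so that it lies in M once y⁻
  -- does.
  set p := (y⁻).ker.starProjection with hp
  have hproj : IsStarProjection p := isStarProjection_starProjection
  have hps := hproj.isSelfAdjoint.star_eq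
  have hpp := hproj.isIdempotentElem.eq
  have hnp : y⁻ * p = 0 := by
    ext b
    exact Submodule.starProjection_apply_mem (y⁻).ker b
  have hpn : p * y⁻ = 0 := by
    have := congr_arg star hnp
    rwa [star_mul, hps, (CFC.negPart_nonneg y).star_eq, star_zero] at this
  have hpP : p * y⁺ = y⁺ := by
    ext b
    refine Submodule.starProjection_eq_self_iff.2 ?_
    change (y⁻ * y⁺) b = 0
    rw [CFC.negPart_mul_posPart]
    rfl
  have hPp : y⁺ * p = y⁺ := by
    have := congr_arg star hpP
    rwa [star_mul, hps, (CFC.posPart_nonneg y).star_eq] at this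
  have hdec : y⁺ - y⁻ = y := CFC.posPart_sub_negPart y
  have hT2 : T + T = y⁺ - y⁻ + 1 := by rw [hdec, hy]; abel
  refine ⟨⟨p, starProjection_ker_mem hneg⟩, ⟨Subtype.ext hpp, Subtype.ext hps⟩, ?_⟩
  have h := nonneg_and_le_one_of_pos_neg_parts hpp hps (CFC.posPart_nonneg y)
    (CFC.negPart_nonneg y) hpP hPp hpn hnp hx.1 hx.2 hT2
  rw [← two_smul ℂ T] at h
  exact h

/-- Passing from x to the positive contraction 2x - p doubles the commutator with a, while the
trivial bound 2‖a‖ persists. -/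
theorem norm_commutator_le_of_commute_isStarProjection {a : M.toStarSubalgebra}
    (h : ∀ p : M.toStarSubalgebra, IsStarProjection p → p * a = a * p) (n : ℕ) :
    ∀ x ∈ effects M, ‖x * a - a * x‖ ≤ 2 * ‖a‖ * (1 / 2) ^ n := by
  induction n with
  | zero =>
    intro x hx
    have hx1 := norm_le_one_of_mem_effects hx
    have h1 : ‖x * a‖ ≤ ‖a‖ :=
      (norm_mul_le _ _).trans (mul_le_of_le_one_left (norm_nonneg _) hx1)
    have h2 : ‖a * x‖ ≤ ‖a‖ :=
      (norm_mul_le _ _).trans (mul_le_of_le_one_right (norm_nonneg _) hx1)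
    refine (norm_sub_le _ _).trans ?_
    rw [pow_zero, mul_one, two_mul]
    exact add_le_add h1 h2
  | succ n ih =>
    intro x hx
    obtain ⟨p, hp, hmem⟩ := exists_isStarProjection_two_smul_sub_mem_effects hx
    have h1 := ih _ hmem
    have h2 : ((2 : ℂ) • x - p) * a - a * ((2 : ℂ) • x - p) = (2 : ℂ) • (x * a - a * x) := by
      rw [sub_mul, mul_sub, h p hp, smul_mul_assoc, mul_smul_comm, smul_sub]
      abel
    rw [h2, norm_smul, Complex.norm_ofNat] at h1
    rw [pow_succ]
    linarith

theorem mem_center_of_commute_isStarProjection {a : M.toStarSubalgebra}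
    (h : ∀ p : M.toStarSubalgebra, IsStarProjection p → p * a = a * p) :
    a ∈ Set.center M.toStarSubalgebra := by
  have heff : ∀ x ∈ effects M, x * a = a * x := fun x hx => by
    have hlim : Filter.Tendsto (fun n : ℕ => 2 * ‖a‖ * (1 / 2 : ℝ) ^ n) Filter.atTop (nhds 0) := by
      simpa using (tendsto_pow_atTop_nhds_zero_of_lt_one (r := (1 / 2 : ℝ)) (by norm_num)
        (by norm_num)).const_mul (2 * ‖a‖)
    have := ge_of_tendsto' hlim fun n => norm_commutator_le_of_commute_isStarProjection h n x hx
    exact sub_eq_zero.1 (norm_le_zero_iff.1 this)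
  have hsa : ∀ y : M.toStarSubalgebra, IsSelfAdjoint y → y * a = a * y := fun y hy => by
    rcases eq_or_ne y 0 with rfl | hy0
    · simp
    have hn : 0 < ‖y‖ := norm_pos_iff.2 hy0
    have h1 := heff _ (smul_add_mem_effects hy hn)
    have hc : (((2 * ‖y‖)⁻¹ : ℝ) : ℂ) ≠ 0 := by
      rw [Complex.ofReal_ne_zero]; positivity
    rw [smul_mul_assoc, mul_smul_comm] at h1
    have h2 := smul_right_injective _ hc h1
    simp only [add_mul, mul_add, smul_mul_assoc, mul_smul_comm, one_mul, mul_one] at h2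
    exact add_left_cancel h2
  rw [Semigroup.mem_center_iff]
  intro x
  rw [← realPart_add_I_smul_imaginaryPart x, add_mul, mul_add, smul_mul_assoc, mul_smul_comm,
    hsa _ (ℜ x).2, hsa _ (ℑ x).2]

/-- Write a - pap = s*s; compressing by p gives (sp)*(sp) = 0, so sp = 0 and ap = pap, which is
self-adjoint. -/
theorem commute_of_compression_le {a p : M.toStarSubalgebra} (ha : 0 ≤ (a : H →L[ℂ] H))
    (hp : IsStarProjection p) (h : ((p * a * p : M.toStarSubalgebra) : H →L[ℂ] H) ≤ a) :
    p * a = a * p := by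
  obtain ⟨s, hs⟩ := CStarAlgebra.nonneg_iff_eq_star_mul_self.1 (sub_nonneg.2 h)
  set P : H →L[ℂ] H := (p : H →L[ℂ] H)
  set A : H →L[ℂ] H := (a : H →L[ℂ] H)
  have hPP : P * P = P := congr_arg Subtype.val hp.isIdempotentElem.eq
  have hPs : star P = P := congr_arg Subtype.val hp.isSelfAdjoint.star_eq
  have hs' : A - P * A * P = star s * s := hs
  have h0 : star (s * P) * (s * P) = 0 := by
    have : star (s * P) * (s * P) = P * (star s * s) * P := by
      rw [star_mul, hPs]; simp only [mul_assoc]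
    rw [this, ← hs']
    simp only [mul_sub, sub_mul, mul_assoc, hPP]
    simp only [← mul_assoc, hPP, sub_self]
  have h1 : s * P = 0 := CStarRing.star_mul_self_eq_zero_iff _ |>.1 h0
  have h2 : A * P = P * A * P := by
    have : (A - P * A * P) * P = 0 := by rw [hs', mul_assoc, h1, mul_zero]
    rw [sub_mul, mul_assoc (P * A), hPP, sub_eq_zero] at this
    exact this
  have h3 : P * A = P * A * P := by
    have := congr_arg star h2
    simp only [star_mul, hPs, (IsSelfAdjoint.of_nonneg ha).star_eq] at this
    exact this.trans (mul_assoc _ _ _).symm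
  exact Subtype.ext (h3.trans h2.symm)

theorem compression_le_of_mem_center {a p : M.toStarSubalgebra} (ha : 0 ≤ (a : H →L[ℂ] H))
    (hc : a ∈ Set.center M.toStarSubalgebra) (hp : IsStarProjection p) :
    ((p * a * p : M.toStarSubalgebra) : H →L[ℂ] H) ≤ a := by
  have hpa := Semigroup.mem_center_iff.1 hc p
  have hpp := hp.isIdempotentElem.eq
  have h1 := star_left_conjugate_nonneg ha ((1 - p : M.toStarSubalgebra) : H →L[ℂ] H)
  have h2 : star (1 - p) * a * (1 - p) = a - p * a * p := by
    rw [hp.one_sub.isSelfAdjoint.star_eq]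
    have e : (1 - p) * a * (1 - p) = a - p * a - a * p + p * a * p := by noncomm_ring
    rw [e, hpa, mul_assoc, hpp]
    abel
  have h3 : 0 ≤ ((star (1 - p) * a * (1 - p) : M.toStarSubalgebra) : H →L[ℂ] H) := h1
  rw [h2] at h3
  exact sub_nonneg.1 h3

end Center

/-! ### Calculus of positive parts and absolute values. -/

section Parts

variable {H : Type*} [NormedAddCommGroup H] [InnerProductSpace ℂ H] [CompleteSpace H]
  {M : VonNeumannAlgebra H} {φ ψ : Functional M}

theorem isNormal_zero : IsNormal (0 : Functional M) :=
  ⟨0, 0, by simp [summable_zero], by simp [summable_zero], fun x => by simp [hasSum_zero]⟩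

theorem zero_mem_posNormal : (0 : Functional M) ∈ posNormal M :=
  ⟨isNormal_zero, fun _ _ => le_rfl⟩

theorem mem_hermNormal_of_mem_posNormal (hφ : φ ∈ posNormal M) : φ ∈ hermNormal M :=
  ⟨hφ.1, hφ.2.isHerm⟩

theorem add_mem_posNormal (hφ : φ ∈ posNormal M) (hψ : ψ ∈ posNormal M) : φ + ψ ∈ posNormal M :=
  ⟨hφ.1.add hψ.1, hφ.2.add hψ.2⟩

theorem smul_mem_posNormal (hφ : φ ∈ posNormal M) {c : ℂ} (hc : 0 ≤ c) : c • φ ∈ posNormal M :=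
  ⟨hφ.1.smul c, hφ.2.smul hc⟩

theorem compression_mem_posNormal (hφ : φ ∈ posNormal M) (c : M.toStarSubalgebra) :
    compression (star c) c φ ∈ posNormal M :=
  ⟨hφ.1.compression _ _, hφ.2.compression c⟩

theorem add_mem_hermNormal (hφ : φ ∈ hermNormal M) (hψ : ψ ∈ hermNormal M) :
    φ + ψ ∈ hermNormal M :=
  ⟨hφ.1.add hψ.1, hφ.2.add hψ.2⟩

theorem sub_mem_hermNormal (hφ : φ ∈ hermNormal M) (hψ : ψ ∈ hermNormal M) :
    φ - ψ ∈ hermNormal M :=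
  ⟨hφ.1.sub hψ.1, hφ.2.sub hψ.2⟩

theorem coe_smul_functional (t : ℝ) (φ : Functional M) : (t : ℂ) • φ = t • φ := by
  ext x
  exact Complex.coe_smul t (φ x)

theorem smul_mem_hermNormal (hφ : φ ∈ hermNormal M) (t : ℝ) : t • φ ∈ hermNormal M := by
  rw [← coe_smul_functional]
  exact ⟨hφ.1.smul _, hφ.2.smul (Complex.conj_ofReal t)⟩

theorem posPart_of_mem_posNormal (hφ : φ ∈ posNormal M) : posPart φ = φ :=
  IsOrthogonalDecomposition.posPart_eq (φ₂ := 0) (p := 1)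
    ⟨hφ, zero_mem_posNormal, by simp, .one _, by simp, by simp⟩

theorem posPart_neg_of_mem_posNormal (hφ : φ ∈ posNormal M) : posPart (-φ) = 0 :=
  IsOrthogonalDecomposition.posPart_eq (φ₂ := φ) (p := 0)
    ⟨zero_mem_posNormal, hφ, by simp, .zero _, by simp, by simp⟩

theorem posPart_mem_posNormal (hφ : φ ∈ hermNormal M) : posPart φ ∈ posNormal M := by
  obtain ⟨φ₁, φ₂, p, h⟩ := exists_isOrthogonalDecomposition hφ
  rw [h.posPart_eq]
  exact h.left_mem

theorem exists_eq_posPart_sub (hφ : φ ∈ hermNormal M) :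
    ∃ φ₂ ∈ posNormal M, φ = posPart φ - φ₂ := by
  obtain ⟨φ₁, φ₂, p, h⟩ := exists_isOrthogonalDecomposition hφ
  exact ⟨φ₂, h.right_mem, by rw [h.posPart_eq]; exact h.eq_sub⟩

theorem exists_posPart_eq_compression (hφ : φ ∈ hermNormal M) :
    ∃ p : M.toStarSubalgebra, IsStarProjection p ∧ ∀ x, posPart φ x = φ (p * x * p) := by
  obtain ⟨φ₁, φ₂, p, h⟩ := exists_isOrthogonalDecomposition hφ
  refine ⟨p, h.isStarProjection, fun x => ?_⟩
  have h1 := (h.left_mem.2.apply_mul_eq_zero_of_proj h.isStarProjection.one_sub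
    (by simp [h.left_eq_zero]) x).1
  rw [sub_mul, one_mul, map_sub, sub_eq_zero] at h1
  rw [h.posPart_eq, h1, h.left_apply]

theorem absVal_eq_two_smul_posPart_sub (hφ : φ ∈ hermNormal M) :
    absVal φ = (2 : ℂ) • posPart φ - φ := by
  obtain ⟨φ₁, φ₂, p, h⟩ := exists_isOrthogonalDecomposition hφ
  rw [h.absVal_eq, h.posPart_eq, h.eq_sub]
  module

theorem posPart_smul (hφ : φ ∈ hermNormal M) {t : ℝ} (ht : 0 ≤ t) :
    posPart (t • φ) = t • posPart φ := by
  obtain ⟨φ₁, φ₂, p, h⟩ := exists_isOrthogonalDecomposition hφ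
  have hc : (0 : ℂ) ≤ (t : ℂ) := Complex.zero_le_real.2 ht
  rw [h.posPart_eq, ← coe_smul_functional, ← coe_smul_functional]
  refine IsOrthogonalDecomposition.posPart_eq (φ₂ := (t : ℂ) • φ₂) (p := p)
    ⟨smul_mem_posNormal h.left_mem hc, smul_mem_posNormal h.right_mem hc, ?_, h.isStarProjection,
      ?_, ?_⟩
  · rw [h.eq_sub, smul_sub]
  · rw [smul_apply, h.left_eq_zero, smul_zero]
  · rw [smul_apply, h.right_eq_zero, smul_zero]

theorem absVal_smul (hφ : φ ∈ hermNormal M) {t : ℝ} (ht : 0 ≤ t) :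
    absVal (t • φ) = t • absVal φ := by
  rw [absVal_eq_two_smul_posPart_sub hφ,
    absVal_eq_two_smul_posPart_sub (smul_mem_hermNormal hφ t), posPart_smul hφ ht]
  module

/-- For positively homogeneous maps, convexity is subadditivity. -/
theorem convexOn_hermNormal_iff {F : Functional M → ℂ}
    (hF : ∀ φ ∈ hermNormal M, ∀ t : ℝ, 0 ≤ t → F (t • φ) = t • F φ) :
    ConvexOn ℝ (hermNormal M) F ↔
      ∀ φ ∈ hermNormal M, ∀ ψ ∈ hermNormal M, F (φ + ψ) ≤ F φ + F ψ := by
  constructor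
  · rintro ⟨-, h⟩ φ hφ ψ hψ
    have h1 := h (smul_mem_hermNormal hφ 2) (smul_mem_hermNormal hψ 2)
      (a := 1 / 2) (b := 1 / 2) (by norm_num) (by norm_num) (by norm_num)
    rw [hF φ hφ 2 (by norm_num), hF ψ hψ 2 (by norm_num)] at h1
    simpa only [smul_smul, one_div, inv_mul_cancel₀ (two_ne_zero (α := ℝ)), one_smul] using h1
  · refine fun h => ⟨fun φ hφ ψ hψ s t _ _ _ =>
      add_mem_hermNormal (smul_mem_hermNormal hφ s) (smul_mem_hermNormal hψ t),
      fun φ hφ ψ hψ s t hs ht _ => ?_⟩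
    rw [← hF φ hφ s hs, ← hF ψ hψ t ht]
    exact h _ (smul_mem_hermNormal hφ s) _ (smul_mem_hermNormal hψ t)

theorem absVal_add_le_iff {a : M.toStarSubalgebra} (hφ : φ ∈ hermNormal M)
    (hψ : ψ ∈ hermNormal M) :
    absVal (φ + ψ) a ≤ absVal φ a + absVal ψ a ↔
      posPart (φ + ψ) a ≤ posPart φ a + posPart ψ a := by
  rw [absVal_eq_two_smul_posPart_sub hφ, absVal_eq_two_smul_posPart_sub hψ,
    absVal_eq_two_smul_posPart_sub (add_mem_hermNormal hφ hψ), ← sub_nonneg,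
    ← sub_nonneg (a := posPart φ a + posPart ψ a)]
  simp only [sub_apply, add_apply, smul_apply, smul_eq_mul]
  have h : 2 * posPart φ a - φ a + (2 * posPart ψ a - ψ a) -
      (2 * posPart (φ + ψ) a - (φ a + ψ a)) =
      2 * (posPart φ a + posPart ψ a - posPart (φ + ψ) a) := by ring
  rw [h]
  refine ⟨fun h0 => ?_, mul_nonneg zero_le_two⟩
  have h1 := mul_nonneg (show (0 : ℂ) ≤ 1 / 2 by rw [Complex.le_def]; norm_num) h0
  rwa [← mul_assoc, one_div, inv_mul_cancel₀ two_ne_zero, one_mul] at h1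

/-- If `φ⁺ (a)` is minimal among all decompositions of `φ`, then `a` dominates its compressions. -/
theorem compression_le_of_posPart_minimal {a p : M.toStarSubalgebra} (hp : IsStarProjection p)
    (h : ∀ φ ∈ hermNormal M, ∀ φ₁ ∈ posNormal M, ∀ φ₂ ∈ posNormal M, φ = φ₁ - φ₂ →
      posPart φ a ≤ φ₁ a) :
    ((p * a * p : M.toStarSubalgebra) : H →L[ℂ] H) ≤ a := by
  rw [← sub_nonneg, nonneg_iff_inner]
  intro ξ
  set ω := vectorFunctional M ξ with hω
  have hωpos : ω ∈ posNormal M := ⟨isNormal_vectorFunctional ξ, isPos_vectorFunctional ξ⟩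
  have key : ∀ s : ℝ, 0 < s → s < 1 → ((1 - s ^ 2 : ℝ) : ℂ) * ω (p * a * p) ≤ ω a := by
    intro s hs hs1
    -- The weights s and s⁻¹ have product 1, so ω and ω(c · c) have the same off-diagonal terms and
    -- their difference is diagonal with respect to p.
    set c : M.toStarSubalgebra := (s : ℂ) • p + ((s⁻¹ : ℝ) : ℂ) • (1 - p) with hc
    have hcs : star c = c := by
      simp only [hc, star_add, star_smul, hp.isSelfAdjoint.star_eq,
        hp.one_sub.isSelfAdjoint.star_eq, Complex.star_def, Complex.conj_ofReal]
    have hφ₂ : compression c c ω ∈ posNormal M := by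
      have := compression_mem_posNormal hωpos c
      rwa [hcs] at this
    have h1 : compression p p ω ∈ posNormal M := by
      have := compression_mem_posNormal hωpos p
      rwa [hp.isSelfAdjoint.star_eq] at this
    have h2 : compression (1 - p) (1 - p) ω ∈ posNormal M := by
      have := compression_mem_posNormal hωpos (1 - p)
      rwa [hp.one_sub.isSelfAdjoint.star_eq] at this
    have hs2 : s ^ 2 ≤ 1 := pow_le_one₀ hs.le hs1.le
    have hsi : 1 ≤ (s⁻¹) ^ 2 := one_le_pow₀ ((one_le_inv₀ hs).2 hs1.le)
    have horth : IsOrthogonalDecomposition (ω - compression c c ω)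
        (((1 - s ^ 2 : ℝ) : ℂ) • compression p p ω)
        ((((s⁻¹) ^ 2 - 1 : ℝ) : ℂ) • compression (1 - p) (1 - p) ω) p := by
      refine ⟨smul_mem_posNormal h1 (Complex.zero_le_real.2 (sub_nonneg.2 hs2)),
        smul_mem_posNormal h2 (Complex.zero_le_real.2 (sub_nonneg.2 hsi)), ?_, hp, ?_, ?_⟩
      · ext x
        have hss : (s : ℂ) * ((s⁻¹ : ℝ) : ℂ) = 1 := by
          rw [← Complex.ofReal_mul, mul_inv_cancel₀ hs.ne', Complex.ofReal_one]
        have hx : ω x = ω (p * (x * p)) + ω (p * (x * (1 - p))) + ω ((1 - p) * (x * p)) +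
            ω ((1 - p) * (x * (1 - p))) := by
          rw [← map_add, ← map_add, ← map_add]
          congr 1
          noncomm_ring
        have hcx : ω (c * (x * c)) = (s : ℂ) ^ 2 * ω (p * (x * p)) + ω (p * (x * (1 - p))) +
            ω ((1 - p) * (x * p)) + ((s⁻¹ : ℝ) : ℂ) ^ 2 * ω ((1 - p) * (x * (1 - p))) := by
          simp only [hc, add_mul, mul_add, smul_mul_assoc, mul_smul_comm, smul_add, smul_smul,
            map_add, map_smul, smul_eq_mul]
          linear_combination (ω (p * (x * (1 - p))) + ω ((1 - p) * (x * p))) * hss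
        simp only [sub_apply, smul_apply, smul_eq_mul, compression_apply]
        rw [hcx]
        push_cast
        linear_combination hx
      · rw [smul_apply, compression_apply, ← mul_assoc, hp.mul_one_sub_self, zero_mul, map_zero,
          smul_zero]
      · rw [smul_apply, compression_apply, ← mul_assoc, hp.one_sub_mul_self, zero_mul, map_zero,
          smul_zero]
    have := h _ (sub_mem_hermNormal (mem_hermNormal_of_mem_posNormal hωpos)
      (mem_hermNormal_of_mem_posNormal hφ₂)) ω hωpos _ hφ₂ rfl
    rwa [horth.posPart_eq, smul_apply, smul_eq_mul, compression_apply, ← mul_assoc] at this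
  have hlim : Filter.Tendsto (fun s : ℝ => ((1 - s ^ 2 : ℝ) : ℂ) * ω (p * a * p))
      (nhdsWithin 0 (Set.Ioi 0)) (nhds (ω (p * a * p))) := by
    have hcont : Continuous fun s : ℝ => ((1 - s ^ 2 : ℝ) : ℂ) * ω (p * a * p) := by fun_prop
    simpa using (hcont.tendsto 0).mono_left nhdsWithin_le_nhds
  have hle := le_of_tendsto hlim (by
    filter_upwards [Ioo_mem_nhdsGT (zero_lt_one (α := ℝ))] with s hs using key s hs.1 hs.2)
  have := sub_nonneg.2 hle
  rw [← map_sub] at this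
  exact this

end Parts

end VonNeumannAlgebra

/-! ### The equivalences. -/

theorem theorem1 {H : Type*} [NormedAddCommGroup H] [InnerProductSpace ℂ H] [CompleteSpace H]
    (M : VonNeumannAlgebra H) (a : M.toStarSubalgebra) (ha : 0 ≤ (a : H →L[ℂ] H)) :
    List.TFAE [
      -- (i) `a` is central
      a ∈ Set.center M.toStarSubalgebra,
      -- (ii) `p a p ≤ a` for all projections `p` in `M`
      ∀ p : M.toStarSubalgebra, IsStarProjection p →
        ((p * a * p : M.toStarSubalgebra) : H →L[ℂ] H) ≤ a,
      -- (iii) `φ⁺ (a) ≤ φ₁ (a)` whenever `φ = φ₁ - φ₂`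
      ∀ φ ∈ VonNeumannAlgebra.hermNormal M,
        ∀ φ₁ ∈ VonNeumannAlgebra.posNormal M, ∀ φ₂ ∈ VonNeumannAlgebra.posNormal M,
          φ = φ₁ - φ₂ → VonNeumannAlgebra.posPart φ a ≤ φ₁ a,
      -- (iv) `φ ↦ φ⁺ (a)` is monotone
      ∀ φ ∈ VonNeumannAlgebra.hermNormal M, ∀ ψ ∈ VonNeumannAlgebra.hermNormal M,
        VonNeumannAlgebra.IsPos (ψ - φ) →
          VonNeumannAlgebra.posPart φ a ≤ VonNeumannAlgebra.posPart ψ a,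
      -- (v) `φ ↦ φ⁺ (a)` is subadditive
      ∀ φ ∈ VonNeumannAlgebra.hermNormal M, ∀ ψ ∈ VonNeumannAlgebra.hermNormal M,
        VonNeumannAlgebra.posPart (φ + ψ) a ≤
          VonNeumannAlgebra.posPart φ a + VonNeumannAlgebra.posPart ψ a,
      -- (vi) `φ ↦ |φ| (a)` is subadditive
      ∀ φ ∈ VonNeumannAlgebra.hermNormal M, ∀ ψ ∈ VonNeumannAlgebra.hermNormal M,
        VonNeumannAlgebra.absVal (φ + ψ) a ≤
          VonNeumannAlgebra.absVal φ a + VonNeumannAlgebra.absVal ψ a,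
      -- (vii) `φ ↦ φ⁺ (a)` is convex
      ConvexOn ℝ (VonNeumannAlgebra.hermNormal M) (fun φ => VonNeumannAlgebra.posPart φ a),
      -- (viii) `φ ↦ |φ| (a)` is convex
      ConvexOn ℝ (VonNeumannAlgebra.hermNormal M) (fun φ => VonNeumannAlgebra.absVal φ a)] := by
  tfae_have 1 → 2 := fun h p hp => VonNeumannAlgebra.compression_le_of_mem_center ha h hp
  tfae_have 2 → 1 := fun h => VonNeumannAlgebra.mem_center_of_commute_isStarProjection fun p hp =>
    VonNeumannAlgebra.commute_of_compression_le ha hp (h p hp)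
  tfae_have 2 → 3 := by
    intro h φ hφ φ₁ hφ₁ φ₂ hφ₂ heq
    obtain ⟨p, hp, hpφ⟩ := VonNeumannAlgebra.exists_posPart_eq_compression hφ
    rw [hpφ, heq, sub_apply]
    refine (sub_le_self _ (hφ₂.2 _ ?_)).trans (hφ₁.2.mono (h p hp))
    have := star_left_conjugate_nonneg ha (p : H →L[ℂ] H)
    rwa [show star (p : H →L[ℂ] H) = p from congr_arg Subtype.val hp.isSelfAdjoint.star_eq] at this
  tfae_have 3 → 2 := fun h p hp => VonNeumannAlgebra.compression_le_of_posPart_minimal hp h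
  tfae_have 3 → 4 := by
    intro h φ hφ ψ hψ hle
    obtain ⟨ψ₂, hψ₂, heq⟩ := VonNeumannAlgebra.exists_eq_posPart_sub hψ
    -- Decompose φ = ψ⁺ - (ψ⁻ + (ψ - φ)).
    refine h φ hφ _ (VonNeumannAlgebra.posPart_mem_posNormal hψ) (ψ₂ + (ψ - φ))
      (VonNeumannAlgebra.add_mem_posNormal hψ₂
        ⟨(VonNeumannAlgebra.sub_mem_hermNormal hψ hφ).1, hle⟩) ?_
    rw [← sub_sub, ← heq, sub_sub_cancel]
  tfae_have 4 → 3 := by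
    intro h φ hφ φ₁ hφ₁ φ₂ hφ₂ heq
    have := h φ hφ φ₁ (VonNeumannAlgebra.mem_hermNormal_of_mem_posNormal hφ₁)
      (by rw [heq, sub_sub_cancel]; exact hφ₂.2)
    rwa [VonNeumannAlgebra.posPart_of_mem_posNormal hφ₁] at this
  tfae_have 3 → 5 := by
    intro h φ hφ ψ hψ
    obtain ⟨φ₂, hφ₂, hφeq⟩ := VonNeumannAlgebra.exists_eq_posPart_sub hφ
    obtain ⟨ψ₂, hψ₂, hψeq⟩ := VonNeumannAlgebra.exists_eq_posPart_sub hψ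
    refine h _ (VonNeumannAlgebra.add_mem_hermNormal hφ hψ) _
      (VonNeumannAlgebra.add_mem_posNormal (VonNeumannAlgebra.posPart_mem_posNormal hφ)
        (VonNeumannAlgebra.posPart_mem_posNormal hψ)) _
      (VonNeumannAlgebra.add_mem_posNormal hφ₂ hψ₂) ?_
    rw [add_sub_add_comm, ← hφeq, ← hψeq]
  tfae_have 5 → 3 := by
    intro h φ hφ φ₁ hφ₁ φ₂ hφ₂ heq
    have hneg : -φ₂ ∈ VonNeumannAlgebra.hermNormal M := by
      rw [← zero_sub]
      exact VonNeumannAlgebra.sub_mem_hermNormal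
        (VonNeumannAlgebra.mem_hermNormal_of_mem_posNormal VonNeumannAlgebra.zero_mem_posNormal)
        (VonNeumannAlgebra.mem_hermNormal_of_mem_posNormal hφ₂)
    -- Subadditivity for φ₁ and -φ₂, whose positive parts are φ₁ and 0.
    have := h φ₁ (VonNeumannAlgebra.mem_hermNormal_of_mem_posNormal hφ₁) _ hneg
    rwa [← sub_eq_add_neg, ← heq, VonNeumannAlgebra.posPart_of_mem_posNormal hφ₁,
      VonNeumannAlgebra.posPart_neg_of_mem_posNormal hφ₂, zero_apply, add_zero] at this
  tfae_have 5 ↔ 6 := forall₄_congr fun φ hφ ψ hψ =>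
    (VonNeumannAlgebra.absVal_add_le_iff hφ hψ).symm
  tfae_have 7 ↔ 5 := VonNeumannAlgebra.convexOn_hermNormal_iff fun φ hφ t ht => by
    rw [VonNeumannAlgebra.posPart_smul hφ ht, smul_apply]
  tfae_have 8 ↔ 6 := VonNeumannAlgebra.convexOn_hermNormal_iff fun φ hφ t ht => by
    rw [VonNeumannAlgebra.absVal_smul hφ ht, smul_apply]
  tfae_finish
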